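/- **Setting.** A *generalized braid theory* consists of a finite set of crossing types (tags), closed under an involution $a\mapsto\bar a$ exchanging the positive and negative version of a tag (possibly $\bar a=a$), together with a specification of which Reidemeister-type moves are allowed. For $n\ge 1$ let $a_i$ ($1\le i\le n-1$) be the elementary diagram on $n$ strands with a single crossing, of type $a$, between the $i$-th and $(i+1)$-st positions. Braid diagrams on $n$ strands are, up to planar isotopy, products (concatenations from top to bottom) of such elementary diagrams, where planar isotopy interchanges distant crossings: $a_ib_j=b_ja_i$ for $|i-j|>1$. The moves that a theory may allow are - $R_2(a)$: $a_i\bar a_i=1=\bar a_ia_i$ for all $i$; - $R_3(a,b,c)$: $a_i\,c_{i+1}\,b_i=b_{i+1}\,c_i\,a_{i+1}$ for all $i$ (so $c$ is the type of the crossing of the two outer strands); - $R_4(a,b)$: $a_ib_i=b_ia_i$ for all $i$. A *generalized braid* on $n$ strands is a diagram up to isotopy and finite sequences of allowed moves, applied anywhere in the diagram; these braids form the set $gB_n$, with concatenation as product. A braid is *pure* if each strand ends at the position where it starts, i.e. if it lies in the kernel of the homomorphism $gB_n\to S_n$ that sends every $a_i$ to the transposition $(i\ \,i+1)$. The theory is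 *normal* if $R_2(a)$ is allowed for every tag $a$ (so that $gB_n$ is a group with $a_i^{-1}=\bar a_i$) and there is a dominant tag $x$, i.e. $R_3(\bar x,x,a)$ and $R_3(x,\bar x,a)$ are allowed for every tag $a$. A braid $\beta\in gB_n$ is *quasitoric* if for some positive integer $q$ $$\beta=\beta_1\beta_2\cdots\beta_q,\qquad \beta_j=y_{j,n-1}\,y_{j,n-2}\cdots y_{j,1},$$ where each $y_{j,i}$ is an elementary braid $a_i$ for some crossing type $a$ (positive or negative), chosen independently for each pair $(j,i)$. **Theorem.** In every normal generalized braid theory and for every $n\ge 1$, every pure braid $\beta\in gB_n$ is quasitoric. -/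

import Mathlib

universe u

/-- A generalized braid theory: finitely many crossing types, the involution `a ↦ ā` exchanging the
positive and the negative version of a tag (possibly `ā = a`), and the specification of which
Reidemeister moves are allowed.  `Tag` contains both versions `a`, `ā` of every tag. -/
structure BraidTheory where
  Tag : Type u
  finite_tag : Finite Tag
  bar : Tag → Tag
  bar_bar : ∀ a, bar (bar a) = a
  /-- `R2 a`: the second Reidemeister move `R₂(a)` is allowed. -/
  R2 : Tag → Prop
  /-- `R3 a b c`: the third Reidemeister move `R₃(a, b, c)` is allowed. If `A`, `B`, `C` are the
  three strands in their order at the top, `a` is the crossing of `A` and `B`, `b` the crossing of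
  `B` and `C`, and `c` the crossing of the outer strands `A` and `C`. -/
  R3 : Tag → Tag → Tag → Prop
  /-- `R4 a b`: consecutive crossings of types `a` and `b` of the same two strands may be
  interchanged (as for real and singular crossings; may be empty). -/
  R4 : Tag → Tag → Prop

namespace BraidTheory

/-- An elementary diagram on `n` strands: one crossing, between the adjacent positions `i` and
`i + 1` (counted from `0`), together with its type. -/
structure Crossing (T : BraidTheory.{u}) (n : ℕ) where
  pos : Fin (n - 1)
  tag : T.Tag

/-- Braid diagrams on `n` strands with crossings at distinct heights, listed from top to bottom.
The product is concatenation; the unit is the diagram without crossings. -/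
abbrev Diagram (T : BraidTheory.{u}) (n : ℕ) : Type u := FreeMonoid (T.Crossing n)

/-- The diagram with a single crossing of type `a` at the positions `i`, `i + 1`. -/
def Diagram.single {T : BraidTheory.{u}} {n : ℕ} (i : Fin (n - 1)) (a : T.Tag) : T.Diagram n :=
  FreeMonoid.of ⟨i, a⟩

open Diagram in
/-- The local changes of a diagram: the planar isotopy that exchanges the heights of two crossings
having no strand position in common, and the R-moves allowed in the theory. -/
inductive Move (T : BraidTheory.{u}) (n : ℕ) : T.Diagram n → T.Diagram n → Prop
  | isotopy (i j : Fin (n - 1)) (a b : T.Tag) (h : (i : ℕ) + 1 < (j : ℕ)) :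
      Move T n (single i a * single j b) (single j b * single i a)
  | r2 (i : Fin (n - 1)) (a : T.Tag) (h : T.R2 a) :
      Move T n (single i a * single i (T.bar a)) 1
  | r2' (i : Fin (n - 1)) (a : T.Tag) (h : T.R2 a) :
      Move T n (single i (T.bar a) * single i a) 1
  | r3 (i j : Fin (n - 1)) (hij : (j : ℕ) = (i : ℕ) + 1) (a b c : T.Tag) (h : T.R3 a b c) :
      Move T n (single i a * single j c * single i b) (single j b * single i c * single j a)
  | r4 (i : Fin (n - 1)) (a b : T.Tag) (h : T.R4 a b) :
      Move T n (single i a * single i b) (single i b * single i a)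

/-- Generalized braids on `n` strands: diagrams modulo finite sequences of isotopies and allowed
R-moves, applied anywhere in a diagram and in both directions. -/
abbrev Braid (T : BraidTheory.{u}) (n : ℕ) : Type u := PresentedMonoid (T.Move n)

/-- The elementary braid `a_i`. -/
def elem {T : BraidTheory.{u}} {n : ℕ} (i : Fin (n - 1)) (a : T.Tag) : T.Braid n :=
  PresentedMonoid.mk (T.Move n) (Diagram.single i a)

/-- The transposition of the positions `i` and `i + 1`. -/
def adjSwap {n : ℕ} (i : Fin (n - 1)) : Equiv.Perm (Fin n) :=
  Equiv.swap ⟨i, by omega⟩ ⟨i + 1, by omega⟩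

theorem adjSwap_comm {n : ℕ} (i j : Fin (n - 1)) (h : (i : ℕ) + 1 < (j : ℕ)) :
    adjSwap i * adjSwap j = adjSwap j * adjSwap i := by
  ext k
  simp only [adjSwap, Equiv.Perm.mul_apply, Equiv.swap_apply_def, Fin.ext_iff]
  grind

theorem adjSwap_braid {n : ℕ} (i j : Fin (n - 1)) (h : (j : ℕ) = (i : ℕ) + 1) :
    adjSwap i * adjSwap j * adjSwap i = adjSwap j * adjSwap i * adjSwap j := by
  ext k
  simp only [adjSwap, Equiv.Perm.mul_apply, Equiv.swap_apply_def, Fin.ext_iff]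
  grind

/-- The natural homomorphism from braids to permutations: `T.perm n β k` is the position at the top of
the strand whose position at the bottom is `k`. -/
def perm (T : BraidTheory.{u}) (n : ℕ) : T.Braid n →* Equiv.Perm (Fin n) :=
  PresentedMonoid.lift (fun c : T.Crossing n => adjSwap c.pos) (by
    intro x y hxy
    cases hxy with
    | isotopy i j a b h => simpa [Diagram.single] using adjSwap_comm i j h
    | r2 i a h => simp [Diagram.single, adjSwap]
    | r2' i a h => simp [Diagram.single, adjSwap]
    | r3 i j hij a b c h => simpa [Diagram.single] using adjSwap_braid i j hij
    | r4 i a b h => simp [Diagram.single])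

/-- The pure braids on `n` strands: the kernel of the map to permutations. -/
def pureBraids (T : BraidTheory.{u}) (n : ℕ) : Submonoid (T.Braid n) :=
  MonoidHom.mker (T.perm n)

/-- A theory is regular if all moves `R₂(a)` are allowed (so that its braids form groups). -/
def IsRegular (T : BraidTheory.{u}) : Prop := ∀ a, T.R2 a

/-- The crossing type `x` dominates the theory. -/
def Dominates (T : BraidTheory.{u}) (x : T.Tag) : Prop :=
  ∀ a, T.R3 (T.bar x) x a ∧ T.R3 x (T.bar x) a

/-- A theory is normal if it is regular and has a dominant tag. -/
def IsNormal (T : BraidTheory.{u}) : Prop := T.IsRegular ∧ ∃ x, T.Dominates x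

/-- The block `y_{n-1} y_{n-2} ⋯ y_1`, where `y_i` is the elementary braid at the `i`-th pair of
adjacent positions with the prescribed crossing type. -/
def block {T : BraidTheory.{u}} {n : ℕ} (y : Fin (n - 1) → T.Tag) : T.Braid n :=
  ((List.finRange (n - 1)).reverse.map fun i => elem i (y i)).prod

/-- A braid on `n` strands is quasitoric of type `(n, q)` if it is a product of `q` blocks. -/
def IsQuasitoricOfType {T : BraidTheory.{u}} {n : ℕ} (q : ℕ) (β : T.Braid n) : Prop :=
  ∃ y : Fin q → Fin (n - 1) → T.Tag, β = (List.ofFn fun j => block (y j)).prod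

/-- A braid on `n` strands is quasitoric if it is quasitoric of type `(n, q)` for some positive
integer `q`. -/
def IsQuasitoric {T : BraidTheory.{u}} {n : ℕ} (β : T.Braid n) : Prop :=
  ∃ q : ℕ, 0 < q ∧ IsQuasitoricOfType q β

end BraidTheory

/-! The proof is by induction on the number of strands. Let `δ` be the block all of whose crossings
have the dominant type `x`.

Adding a strand: on `m + 1` strands, the all-`x` block followed by `m` blocks with `x⁻¹` inserted at
places `0, 1, …` equals any prescribed product of `m` blocks on the first `m` strands
(`exists_seg_mul_eq`). Since every block rotates the strands cyclically, a pure product of blocks on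
`m` strands has a multiple of `m` factors, so it remains a product of blocks after a strand is added
(`addStrand_mem_blockProducts`).

Normal form: every braid is `q * addStrand γ * (run of x)`, with `q` a pure product of blocks. Right
multiplication by a generator at either end of the run creates a conjugate of `x_n a_n` or `a_n
x_n⁻¹`, with `n` the last position and the conjugator on all strands but the last. Such an element
commutes with all braids that leave out the last two strands. Modulo pure conjugators, covered by
induction, only the strand brought to the end therefore matters, and one explicit conjugator per
strand suffices (`pow_mul_mul_pow_mem`, `conj_mul_pow_mem`). For a pure braid the run is empty and
`γ` is pure, so induction applies. -/

namespace BraidTheory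

/-! ### Descending products -/

section DescendingProducts

variable {G H : Type*} [Monoid G] [Monoid H]

/-- The descending product `y (k + r - 1) * ⋯ * y (k + 1) * y k`. -/
def seg (y : ℕ → G) (k : ℕ) : ℕ → G
  | 0 => 1
  | r + 1 => y (k + r) * seg y k r

@[simp] theorem seg_zero (y : ℕ → G) (k : ℕ) : seg y k 0 = 1 := rfl

theorem seg_succ (y : ℕ → G) (k r : ℕ) : seg y k (r + 1) = y (k + r) * seg y k r := rfl

theorem seg_add (y : ℕ → G) (k r s : ℕ) :
    seg y k (r + s) = seg y (k + r) s * seg y k r := by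
  induction s with
  | zero => simp
  | succ s ih => rw [← add_assoc, seg_succ, ih, seg_succ, mul_assoc, add_assoc]

theorem seg_succ' (y : ℕ → G) (k r : ℕ) : seg y k (r + 1) = seg y (k + 1) r * y k := by
  rw [add_comm r 1, seg_add]
  simp [seg_succ]

theorem map_seg (f : G →* H) (y : ℕ → G) (k r : ℕ) :
    f (seg y k r) = seg (fun i => f (y i)) k r := by
  induction r with
  | zero => simp
  | succ r ih => simp [seg_succ, ih]

theorem seg_congr {y z : ℕ → G} {k r : ℕ} (h : ∀ i, k ≤ i → i < k + r → y i = z i) :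
    seg y k r = seg z k r := by
  induction r with
  | zero => rfl
  | succ r ih =>
    rw [seg_succ, seg_succ, ih fun i h₁ h₂ => h i h₁ (by omega), h _ (by omega) (by omega)]

theorem commute_seg {g : G} {y : ℕ → G} {k r : ℕ}
    (h : ∀ i, k ≤ i → i < k + r → Commute g (y i)) : Commute g (seg y k r) := by
  induction r with
  | zero => exact Commute.one_right g
  | succ r ih =>
    exact (h _ (by omega) (by omega)).mul_right (ih fun i h₁ h₂ => h i h₁ (by omega))

end DescendingProducts

/-! ### Block identities from a dominant tag -/

section DominantSystems

/-- Elements `e i a` of a group, for positions `i < n`, that satisfy the relations of a regular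
braid theory with a dominant tag `x`. -/
structure DominantSystem {G τ : Type*} [Group G] (e : ℕ → τ → G) (x x' : τ) (n : ℕ) : Prop where
  comm : ∀ {i j}, i + 1 < j → j < n → ∀ a b, Commute (e i a) (e j b)
  slide : ∀ {i}, i + 1 < n → ∀ a,
    e i a * (e (i + 1) x * e i x) = e (i + 1) x * e i x * e (i + 1) a
  turn : ∀ {i}, i + 1 < n → ∀ a,
    e (i + 1) x * e i a = (e i x)⁻¹ * e (i + 1) a * e i x * e (i + 1) x
  inv : ∀ {i}, i < n → e i x' = (e i x)⁻¹

/-- The block `e (n - 1) (y (n - 1)) * ⋯ * e 0 (y 0)`. -/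
def blk {G τ : Type*} [Monoid G] (e : ℕ → τ → G) (n : ℕ) (y : ℕ → τ) : G :=
  seg (fun i => e i (y i)) 0 n

/-- The products of blocks. -/
def blockProducts {G τ : Type*} [Monoid G] (e : ℕ → τ → G) (n : ℕ) : Submonoid G :=
  Submonoid.closure (Set.range (blk e n))

theorem blk_mem {G τ : Type*} [Monoid G] (e : ℕ → τ → G) (n : ℕ) (y : ℕ → τ) :
    blk e n y ∈ blockProducts e n :=
  Submonoid.subset_closure ⟨y, rfl⟩

/-- The sequence `y` with `c` inserted at place `k`. -/
def insertTag {τ : Type*} (y : ℕ → τ) (k : ℕ) (c : τ) (i : ℕ) : τ :=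
  if i < k then y i else if i = k then c else y (i - 1)

namespace DominantSystem

variable {G τ : Type*} [Group G] {e : ℕ → τ → G} {x x' : τ} {n : ℕ}

theorem commute_seg_above (S : DominantSystem e x x' n) {i k r : ℕ} (h : i + 1 < k)
    (hn : k + r ≤ n) (a : τ) (y : ℕ → τ) : Commute (e i a) (seg (fun j => e j (y j)) k r) :=
  commute_seg fun _ _ _ => S.comm (by omega) (by omega) _ _

theorem commute_seg_below (S : DominantSystem e x x' n) {i k r : ℕ} (h : k + r < i)
    (hn : i < n) (a : τ) (y : ℕ → τ) : Commute (e i a) (seg (fun j => e j (y j)) k r) :=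
  commute_seg fun _ _ _ => (S.comm (by omega) (by omega) _ _).symm

/-- Only the crossings of the run at `i + 1` and `i` matter, and `slide` handles them: the higher
ones commute with `e i a`, the lower ones with `e (i + 1) a`. -/
theorem slide_seg (S : DominantSystem e x x' n) {i k r : ℕ} (hk : k ≤ i) (hi : i + 1 < k + r)
    (hn : k + r ≤ n) (a : τ) :
    e i a * seg (e · x) k r = seg (e · x) k r * e (i + 1) a := by
  obtain ⟨s, rfl⟩ := Nat.exists_eq_add_of_le hk
  obtain ⟨u, rfl⟩ := Nat.exists_eq_add_of_le (show s + 2 ≤ r by omega)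
  have h₁ : Commute (e (k + s) a) (seg (e · x) (k + (s + 2)) u) :=
    S.commute_seg_above (by omega) (by omega) a fun _ => x
  have h₂ : Commute (e (k + s + 1) a) (seg (e · x) k s) :=
    S.commute_seg_below (by omega) (by omega) a fun _ => x
  have h₃ := S.slide (i := k + s) (by omega) a
  rw [seg_add, seg_succ, seg_succ, ← mul_assoc, h₁.eq, mul_assoc, mul_assoc, mul_assoc, mul_assoc,
    ← h₂.eq, ← add_assoc]
  simp only [← mul_assoc, ← add_assoc] at h₃ ⊢
  rw [mul_assoc _ (e (k + s) a), mul_assoc _ (e (k + s) a * _), h₃]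
  simp only [mul_assoc]

theorem seg_mul_seg (S : DominantSystem e x x' n) {k r s : ℕ} (hs : s < r) (hn : k + r ≤ n)
    (y : ℕ → τ) :
    seg (e · x) k r * seg (fun i => e i (y i)) (k + 1) s =
      seg (fun i => e i (y (i + 1))) k s * seg (e · x) k r := by
  induction s with
  | zero => simp
  | succ s ih =>
    rw [seg_succ, seg_succ, mul_assoc _ _ (seg (e · x) k r), ← ih (by omega), ← mul_assoc,
      ← mul_assoc, S.slide_seg (by omega) (by omega) hn]
    simp only [add_right_comm]

/-- Iterating `turn` carries the crossing `a` up to the top position `k + r`, at the cost of a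
conjugation. -/
theorem seg_mul_elem (S : DominantSystem e x x' n) {k r : ℕ} (hn : k + r < n) (a : τ) :
    seg (e · x) (k + 1) r * e k a =
      (seg (e · x) k r)⁻¹ * e (k + r) a * seg (e · x) k r * seg (e · x) (k + 1) r := by
  induction r with
  | zero => simp
  | succ r ih =>
    have h₁ : Commute (e (k + r + 1) x) (seg (e · x) k r) :=
      S.commute_seg_below (by omega) (by omega) x fun _ => x
    have h₂ := S.turn (i := k + r) (by omega) a
    have h₃ := h₁.inv_right.eq
    rw [seg_succ _ (k + 1), mul_assoc, ih (by omega), seg_succ, add_right_comm k 1 r]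
    simp only [mul_inv_rev, ← mul_assoc]
    rw [h₃, mul_assoc _ _ (e (k + r) a), h₂]
    simp only [mul_assoc]
    rw [← mul_assoc _ (seg (e · x) k r), h₁.eq]
    simp only [mul_assoc, add_assoc]

theorem seg_mul_elem_mul (S : DominantSystem e x x' n) {k r : ℕ} (hn : k + r < n) (a : τ) :
    seg (e · x) k (r + 1) * e k a = (seg (e · x) k r)⁻¹ * (e (k + r) x * e (k + r) a) *
      seg (e · x) k r * seg (e · x) (k + 1) r := by
  rw [seg_succ', S.seg_mul_elem hn x, mul_assoc, S.seg_mul_elem hn a]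
  group

theorem seg_mul_elem_div (S : DominantSystem e x x' n) {k r : ℕ} (hn : k + r < n) (a : τ) :
    seg (e · x) (k + 1) r * e k a = (seg (e · x) k r)⁻¹ * (e (k + r) a * (e (k + r) x)⁻¹) *
      seg (e · x) k r * seg (e · x) k (r + 1) := by
  rw [seg_succ' _ k r, S.seg_mul_elem hn x, S.seg_mul_elem hn a]
  group

theorem blk_insertTag (k r : ℕ) (y : ℕ → τ) (c : τ) :
    blk e (k + r + 1) (insertTag y k c) =
      seg (fun i => e i (y (i - 1))) (k + 1) r * e k c * seg (fun i => e i (y i)) 0 k := by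
  rw [blk, add_assoc, seg_add, zero_add, seg_succ']
  congr 1
  · congr 1
    · exact seg_congr fun i h _ => by
        rw [insertTag, if_neg (by omega), if_neg (by omega)]
    · simp [insertTag]
  · exact seg_congr fun i _ h => by rw [insertTag, if_pos (by omega)]

/-- The run of `x` moves the crossings above place `k` down by one position, which undoes the shift
made by `insertTag`. -/
theorem seg_mul_blk (S : DominantSystem e x x' n) {k r : ℕ} (hn : k + r + 1 = n) (y : ℕ → τ)
    (c : τ) :
    seg (e · x) k (r + 1) * blk e n (insertTag y k c) =
      seg (fun i => e i (y i)) k r * (seg (e · x) k (r + 1) * e k c) *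
        seg (fun i => e i (y i)) 0 k := by
  subst hn
  rw [blk_insertTag, ← mul_assoc, ← mul_assoc,
    S.seg_mul_seg (by omega) (by omega) fun i => y (i - 1)]
  simp [mul_assoc]

theorem commute_seg_seg (S : DominantSystem e x x' n) {k r : ℕ} (hn : k + 1 + r ≤ n) (y : ℕ → τ) :
    Commute (seg (e · x) (k + 1) r) (seg (fun i => e i (y i)) 0 k) :=
  commute_seg fun i _ h =>
    (S.commute_seg_above (i := i) (k := k + 1) (by omega) hn (y i) fun _ => x).symm

/-- The inserted `x⁻¹` cancels the lowest crossing of the run; what is left is a block on one strand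
fewer and a shorter run. -/
theorem seg_mul_blk_inv (S : DominantSystem e x x' n) {k r : ℕ} (hn : k + r + 1 = n)
    (y : ℕ → τ) :
    seg (e · x) k (r + 1) * blk e n (insertTag y k x') =
      blk e (k + r) y * seg (e · x) (k + 1) r := by
  rw [S.seg_mul_blk hn, seg_succ', S.inv (by omega), mul_inv_cancel_right, mul_assoc,
    (S.commute_seg_seg (by omega) y).eq, blk, seg_add, zero_add, mul_assoc]

theorem exists_seg_mul_eq (S : DominantSystem e x x' (n + 1)) (l : List (ℕ → τ)) (k : ℕ)
    (hl : k + l.length ≤ n + 1) :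
    ∃ q ∈ blockProducts e (n + 1), seg (e · x) k (n + 1 - k) * q =
      (l.map (blk e n)).prod * seg (e · x) (k + l.length) (n + 1 - (k + l.length)) := by
  induction l generalizing k with
  | nil => exact ⟨1, one_mem _, by simp⟩
  | cons y l ih =>
    simp only [List.length_cons] at hl
    obtain ⟨q, hq, h⟩ := ih (k + 1) (by omega)
    obtain ⟨r, rfl⟩ := Nat.exists_eq_add_of_le (show k ≤ n by omega)
    refine ⟨_, mul_mem (blk_mem e _ (insertTag y k x')) hq, ?_⟩
    rw [show k + r + 1 - (k + 1) = r by omega] at h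
    rw [show k + r + 1 - k = r + 1 by omega, ← mul_assoc, S.seg_mul_blk_inv rfl, mul_assoc, h,
      List.map_cons, List.prod_cons, mul_assoc, List.length_cons, add_assoc k 1, add_comm 1]

theorem seg_mem (e : ℕ → τ → G) (x : τ) (n : ℕ) : seg (e · x) 0 n ∈ blockProducts e n :=
  blk_mem e n fun _ => x

theorem prod_blk_mem_of_length_eq (S : DominantSystem e x x' (n + 1)) (l : List (ℕ → τ))
    (hl : l.length = n + 1) : (l.map (blk e n)).prod ∈ blockProducts e (n + 1) := by
  obtain ⟨q, hq, h⟩ := S.exists_seg_mul_eq l 0 (by omega)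
  rw [show n + 1 - (0 + l.length) = 0 by omega, seg_zero, mul_one] at h
  exact h ▸ mul_mem (seg_mem e x _) hq

theorem prod_blk_mem_of_dvd (S : DominantSystem e x x' (n + 1)) (l : List (ℕ → τ))
    (hl : n + 1 ∣ l.length) : (l.map (blk e n)).prod ∈ blockProducts e (n + 1) := by
  obtain ⟨m, hm⟩ := hl
  induction m generalizing l with
  | zero => simp [List.length_eq_zero_iff.1 (hm.trans (mul_zero _))]
  | succ m ih =>
    rw [mul_add_one] at hm
    rw [← List.take_append_drop (n + 1) l, List.map_append, List.prod_append]
    exact mul_mem (S.prod_blk_mem_of_length_eq _ (by simp [hm])) (ih _ (by simp [hm]))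

theorem exists_seg_mul_eq_pow (S : DominantSystem e x x' (n + 1)) (k m : ℕ) (hl : k + m ≤ n + 1) :
    ∃ q ∈ blockProducts e (n + 1), seg (e · x) k (n + 1 - k) * q =
      seg (e · x) 0 n ^ m * seg (e · x) (k + m) (n + 1 - (k + m)) := by
  simpa [blk] using S.exists_seg_mul_eq (List.replicate m fun _ => x) k (by simpa using hl)

/-- In the product of blocks that yields `δ ^ (n + 1)`, the block with `x⁻¹` inserted at place `k`
is replaced by one with `a` there. Instead of cancelling, this `a` meets the `x` of the run and
leaves `e n x * e n a` between two powers of `δ`. -/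
theorem pow_mul_mul_pow_mem (S : DominantSystem e x x' (n + 1)) {k : ℕ} (hk : k ≤ n) (a : τ) :
    seg (e · x) 0 n ^ k * (e n x * e n a) * seg (e · x) 0 n ^ (n + 1 - k) ∈
      blockProducts e (n + 1) := by
  obtain ⟨r, rfl⟩ := Nat.exists_eq_add_of_le hk
  obtain ⟨q₁, hq₁, h₁⟩ := S.exists_seg_mul_eq_pow 0 k (by omega)
  obtain ⟨q₂, hq₂, h₂⟩ := S.exists_seg_mul_eq_pow (k + 1) r (by omega)
  have h₃ := S.seg_mul_blk (k := k) (r := r) rfl (fun _ => x) a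
  have h₄ := (S.commute_seg_seg (k := k) (r := r) (by omega) fun _ => x).eq
  have h₅ : seg (e · x) 0 (k + r) = seg (e · x) k r * seg (e · x) 0 k := by
    rw [seg_add, zero_add]
  rw [S.seg_mul_elem_mul (by omega)] at h₃
  rw [zero_add, show k + r + 1 - k = r + 1 by omega] at h₁
  rw [show k + r + 1 - (k + 1) = r by omega, show k + r + 1 - (k + 1 + r) = 0 by omega, seg_zero,
    mul_one] at h₂
  convert mul_mem (mul_mem (mul_mem (seg_mem e x _) hq₁) (blk_mem e _ (insertTag (fun _ => x) k a)))
    hq₂ using 1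
  rw [Nat.sub_zero] at h₁
  rw [h₁, mul_assoc (seg (e · x) 0 (k + r) ^ k) (seg (e · x) k (r + 1)), h₃,
    show k + r + 1 - k = r + 1 by omega, pow_succ' _ r, ← h₂]
  simp only [mul_assoc]
  rw [← mul_assoc (seg (e · x) (k + 1) r) (seg (e · x) 0 k) q₂, h₄, h₅]
  simp only [mul_assoc, mul_inv_cancel_left]

/-- Here `a` replaces the crossing at place `k` of the initial all-`x` block. -/
theorem conj_mul_pow_mem (S : DominantSystem e x x' (n + 1)) {k : ℕ} (hk : k ≤ n) (a : τ) :
    (seg (e · x) k (n - k))⁻¹ * (e n a * (e n x)⁻¹) * seg (e · x) k (n - k) *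
      seg (e · x) 0 n ^ (n + 1) ∈ blockProducts e (n + 1) := by
  obtain ⟨r, rfl⟩ := Nat.exists_eq_add_of_le hk
  obtain ⟨q, hq, h⟩ := S.exists_seg_mul_eq_pow 0 (k + r + 1) (by omega)
  rw [show k + r + 1 - (0 + (k + r + 1)) = 0 by omega, seg_zero, mul_one, Nat.sub_zero] at h
  convert mul_mem (blk_mem e _ (insertTag (fun _ => x) k a)) hq using 1
  rw [blk_insertTag, S.seg_mul_elem_div (by omega), ← h, add_assoc k r 1, seg_add _ 0 k, zero_add,
    Nat.add_sub_cancel_left]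
  simp only [mul_assoc]

end DominantSystem

end DominantSystems

end BraidTheory

namespace BraidTheory

/-! ### The group of braids, adding a strand, and permutations -/

section Generators

variable {T : BraidTheory.{u}} {n : ℕ}

/-- The elementary braid `a_i` for a natural number `i`; it is `1` if there is no position `i`. -/
def gen (T : BraidTheory.{u}) (n i : ℕ) (a : T.Tag) : T.Braid n :=
  if h : i < n - 1 then elem ⟨i, h⟩ a else 1

theorem gen_of_lt {i : ℕ} (h : i < n - 1) (a : T.Tag) : gen T n i a = elem ⟨i, h⟩ a := dif_pos h

@[simp] theorem perm_elem (i : Fin (n - 1)) (a : T.Tag) : T.perm n (elem i a) = adjSwap i := rfl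

theorem braid_induction {motive : T.Braid n → Prop} (one : motive 1)
    (mul_gen : ∀ β i a, i < n - 1 → motive β → motive (β * gen T n i a)) (β : T.Braid n) :
    motive β := by
  refine Submonoid.induction_of_closure_eq_top_right
    (PresentedMonoid.closure_range_of (T.Move n)) β one ?_
  rintro β _ ⟨⟨i, a⟩, rfl⟩ h
  have := mul_gen β i a i.2 h
  rwa [gen_of_lt i.2] at this

theorem adjSwap_apply_val (i : Fin (n - 1)) (j : Fin n) :
    (adjSwap i j : ℕ) = if (j : ℕ) = i then (i : ℕ) + 1 else if (j : ℕ) = i + 1 then i else j := by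
  simp only [adjSwap, Equiv.swap_apply_def, Fin.ext_iff]
  split_ifs <;> rfl

theorem perm_gen_apply_val {i : ℕ} (h : i < n - 1) (a : T.Tag) (j : Fin n) :
    (T.perm n (gen T n i a) j : ℕ) =
      if (j : ℕ) = i then i + 1 else if (j : ℕ) = i + 1 then i else j := by
  rw [gen_of_lt h, perm_elem, adjSwap_apply_val]

theorem elem_mul_elem_bar (hT : T.IsRegular) (i : Fin (n - 1)) (a : T.Tag) :
    (elem i a * elem i (T.bar a) : T.Braid n) = 1 :=
  PresentedMonoid.mk_eq_mk_of_rel (Move.r2 i a (hT a))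

theorem elem_bar_mul_elem (hT : T.IsRegular) (i : Fin (n - 1)) (a : T.Tag) :
    (elem i (T.bar a) * elem i a : T.Braid n) = 1 :=
  PresentedMonoid.mk_eq_mk_of_rel (Move.r2' i a (hT a))

theorem isUnit_braid (hT : T.IsRegular) (β : T.Braid n) : IsUnit β := by
  induction β using braid_induction with
  | one => exact isUnit_one
  | mul_gen β i a hi h =>
    rw [gen_of_lt hi]
    exact h.mul ⟨⟨_, _, elem_mul_elem_bar hT _ a, elem_bar_mul_elem hT _ a⟩, rfl⟩

/-- The braids of a regular theory form a group. -/
noncomputable instance braidGroup [hT : Fact T.IsRegular] : Group (T.Braid n) where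
  inv β := ((isUnit_braid hT.out β).unit⁻¹ : (T.Braid n)ˣ)
  inv_mul_cancel β := (isUnit_braid hT.out β).val_inv_mul

theorem dominantSystem_gen [hT : Fact T.IsRegular] {x : T.Tag} (hx : T.Dominates x) :
    DominantSystem (gen T n) x (T.bar x) (n - 1) := by
  have inv : ∀ {i}, i < n - 1 → gen T n i (T.bar x) = (gen T n i x)⁻¹ := fun {i} h => by
    rw [gen_of_lt h, gen_of_lt h, eq_inv_iff_mul_eq_one]
    exact elem_bar_mul_elem hT.out _ x
  refine ⟨fun {i j} hij hj a b => ?_, fun {i} hi a => ?_, fun {i} hi a => ?_, inv⟩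
  · rw [gen_of_lt (by omega), gen_of_lt hj]
    exact PresentedMonoid.mk_eq_mk_of_rel
      (Move.isotopy (⟨i, by omega⟩ : Fin (n - 1)) ⟨j, hj⟩ a b hij)
  · have h : gen T n i x * gen T n (i + 1) a * gen T n i (T.bar x) =
        gen T n (i + 1) (T.bar x) * gen T n i a * gen T n (i + 1) x := by
      simp only [gen_of_lt hi, gen_of_lt (Nat.lt_of_succ_lt hi)]
      exact PresentedMonoid.mk_eq_mk_of_rel (Move.r3 _ _ rfl x (T.bar x) a (hx a).2)
    rw [inv hi, inv (by omega), mul_inv_eq_iff_eq_mul, mul_assoc, mul_assoc,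
      eq_inv_mul_iff_mul_eq] at h
    simpa [mul_assoc] using h.symm
  · have h : gen T n i (T.bar x) * gen T n (i + 1) a * gen T n i x =
        gen T n (i + 1) x * gen T n i a * gen T n (i + 1) (T.bar x) := by
      simp only [gen_of_lt hi, gen_of_lt (Nat.lt_of_succ_lt hi)]
      exact PresentedMonoid.mk_eq_mk_of_rel (Move.r3 _ _ rfl (T.bar x) x a (hx a).1)
    rw [inv hi, inv (by omega), eq_mul_inv_iff_mul_eq] at h
    exact h.symm

/-- A further strand on the right of all strands of a braid. -/
def addStrand (T : BraidTheory.{u}) (n : ℕ) : T.Braid n →* T.Braid (n + 1) :=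
  PresentedMonoid.lift (fun c : T.Crossing n => elem ⟨c.pos, by omega⟩ c.tag) (by
    intro α β h
    cases h with
    | isotopy i j a b h =>
      exact PresentedMonoid.mk_eq_mk_of_rel (rels := T.Move (n + 1))
        (Move.isotopy (n := n + 1) ⟨i, by omega⟩ ⟨j, by omega⟩ a b h)
    | r2 i a h =>
      exact PresentedMonoid.mk_eq_mk_of_rel (Move.r2 (n := n + 1) ⟨i, by omega⟩ a h)
    | r2' i a h =>
      exact PresentedMonoid.mk_eq_mk_of_rel (Move.r2' (n := n + 1) ⟨i, by omega⟩ a h)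
    | r3 i j hij a b c h =>
      exact PresentedMonoid.mk_eq_mk_of_rel (rels := T.Move (n + 1))
        (Move.r3 (n := n + 1) ⟨i, by omega⟩ ⟨j, by omega⟩ hij a b c h)
    | r4 i a b h =>
      exact PresentedMonoid.mk_eq_mk_of_rel (rels := T.Move (n + 1))
        (Move.r4 (n := n + 1) ⟨i, by omega⟩ a b h))

theorem addStrand_gen {i : ℕ} (h : i < n - 1) (a : T.Tag) :
    addStrand T n (gen T n i a) = gen T (n + 1) i a := by
  rw [gen_of_lt h, gen_of_lt (by omega)]
  rfl

theorem addStrand_seg {k r : ℕ} (h : k + r ≤ n - 1) (y : ℕ → T.Tag) :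
    addStrand T n (seg (fun i => gen T n i (y i)) k r) =
      seg (fun i => gen T (n + 1) i (y i)) k r := by
  rw [map_seg]
  exact seg_congr fun i _ hi => addStrand_gen (by omega) _

theorem perm_addStrand_castSucc (β : T.Braid n) (j : Fin n) :
    T.perm (n + 1) (addStrand T n β) j.castSucc = (T.perm n β j).castSucc := by
  induction β using braid_induction generalizing j with
  | one => simp
  | mul_gen β i a hi ih =>
    rw [map_mul, map_mul, map_mul, Equiv.Perm.mul_apply, Equiv.Perm.mul_apply, ← ih,
      addStrand_gen hi]
    congr 1
    ext
    rw [perm_gen_apply_val (by omega), Fin.val_castSucc, Fin.val_castSucc, perm_gen_apply_val hi]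

theorem perm_addStrand_last (β : T.Braid n) :
    T.perm (n + 1) (addStrand T n β) (Fin.last n) = Fin.last n := by
  induction β using braid_induction with
  | one => simp
  | mul_gen β i a hi ih =>
    rw [map_mul, map_mul, Equiv.Perm.mul_apply, addStrand_gen hi]
    convert ih using 2
    ext
    rw [perm_gen_apply_val (by omega), Fin.val_last, if_neg (by omega), if_neg (by omega)]

theorem perm_surjective (a : T.Tag) : Function.Surjective (T.perm n) := by
  rw [← MonoidHom.mrange_eq_top]
  cases n with
  | zero => exact Subsingleton.elim _ _
  | succ n =>
    rw [eq_top_iff, ← Equiv.Perm.mclosure_swap_castSucc_succ, Submonoid.closure_le]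
    rintro _ ⟨i, rfl⟩
    exact ⟨elem i a, rfl⟩

theorem exists_perm_addStrand_eq (a : T.Tag) (π : Equiv.Perm (Fin (n + 1)))
    (hπ : π (Fin.last n) = Fin.last n) :
    ∃ β : T.Braid n, T.perm (n + 1) (addStrand T n β) = π := by
  have hne : ∀ j : Fin n, π j.castSucc ≠ Fin.last n := fun j h =>
    j.castSucc_lt_last.ne (π.injective (h.trans hπ.symm))
  have hinj : Function.Injective fun j : Fin n => (π j.castSucc).castPred (hne j) := by
    intro i j h
    simpa using h
  obtain ⟨β, hβ⟩ := perm_surjective (T := T) a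
    (Equiv.ofBijective _ (Finite.injective_iff_bijective.1 hinj))
  refine ⟨β, Equiv.ext fun j => ?_⟩
  induction j using Fin.lastCases with
  | last => rw [perm_addStrand_last, hπ]
  | cast j => simp [perm_addStrand_castSucc, hβ]

theorem perm_seg_apply_val (y : ℕ → T.Tag) {r : ℕ} (hr : r ≤ n - 1) (j : Fin n) :
    (T.perm n (seg (fun i => gen T n i (y i)) 0 r) j : ℕ) =
      if (j : ℕ) = 0 then r else if (j : ℕ) ≤ r then (j : ℕ) - 1 else j := by
  induction r with
  | zero =>
    simp only [seg_zero, map_one, Equiv.Perm.one_apply]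
    split_ifs <;> omega
  | succ r ih =>
    rw [seg_succ, map_mul, Equiv.Perm.mul_apply, perm_gen_apply_val (by omega), ih (by omega)]
    split_ifs <;> omega

theorem perm_blk_apply_val (y : ℕ → T.Tag) (j : Fin (n + 1)) :
    (T.perm (n + 1) (blk (gen T (n + 1)) n y) j : ℕ) = if (j : ℕ) = 0 then n else (j : ℕ) - 1 := by
  rw [blk, perm_seg_apply_val (r := n) y le_rfl]
  split_ifs <;> omega

theorem perm_prod_blk_modEq (l : List (ℕ → T.Tag)) (j : Fin (n + 1)) :
    (T.perm (n + 1) (l.map (blk (gen T (n + 1)) n)).prod j : ℕ) + l.length ≡ j [MOD n + 1] := by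
  induction l with
  | nil => simp [Nat.ModEq]
  | cons y l ih =>
    rw [List.map_cons, List.prod_cons, map_mul, Equiv.Perm.mul_apply, perm_blk_apply_val,
      List.length_cons]
    refine Nat.ModEq.trans ?_ ih
    split_ifs with h
    -- Position `0` wraps around to `n`, a difference of one full period `n + 1`.
    · rw [h, zero_add, show n + (l.length + 1) = l.length + (n + 1) by omega]
      exact Nat.add_modEq_right
    · exact congrArg (· % (n + 1)) (by omega)

theorem prod_blk_mem_pureBraids_iff (l : List (ℕ → T.Tag)) :
    (l.map (blk (gen T (n + 1)) n)).prod ∈ T.pureBraids (n + 1) ↔ n + 1 ∣ l.length := by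
  rw [pureBraids, MonoidHom.mem_mker]
  refine ⟨fun h => ?_, fun h => Equiv.ext fun j => Fin.ext ?_⟩
  · have := perm_prod_blk_modEq l (0 : Fin (n + 1))
    rw [h, Equiv.Perm.one_apply, Fin.val_zero, zero_add] at this
    exact (Nat.modEq_zero_iff_dvd).1 this
  · have := (perm_prod_blk_modEq l j).trans (Nat.ModEq.add_left j (Nat.modEq_zero_iff_dvd.2 h)).symm
    exact (Nat.ModEq.add_right_cancel' _ this).eq_of_lt_of_lt (Fin.is_lt _) (Fin.is_lt _)

theorem exists_list_of_mem_blockProducts {G τ : Type*} [Monoid G] {e : ℕ → τ → G} {g : G}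
    (hg : g ∈ blockProducts e n) : ∃ l : List (ℕ → τ), (l.map (blk e n)).prod = g := by
  obtain ⟨l, hl, rfl⟩ := Submonoid.exists_list_of_mem_closure hg
  obtain ⟨l, rfl⟩ := (Set.range_list_map (blk e n)).ge hl
  exact ⟨l, rfl⟩

end Generators

end BraidTheory

namespace BraidTheory

/-! ### Induction on the number of strands -/

section PureBraids

variable {T : BraidTheory.{u}} {n : ℕ}

/-- All pure braids on `n + 1` strands are products of blocks. -/
def PureBraidsQuasitoric (T : BraidTheory.{u}) (n : ℕ) : Prop :=
  ∀ β ∈ T.pureBraids (n + 1), β ∈ blockProducts (gen T (n + 1)) n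

theorem addStrand_blk (y : ℕ → T.Tag) :
    addStrand T (n + 1) (blk (gen T (n + 1)) n y) = blk (gen T (n + 2)) n y :=
  addStrand_seg (by omega) y

theorem addStrand_mem_pureBraids {β : T.Braid n} :
    addStrand T n β ∈ T.pureBraids (n + 1) ↔ β ∈ T.pureBraids n := by
  simp only [pureBraids, MonoidHom.mem_mker]
  refine ⟨fun h => Equiv.ext fun j => ?_, fun h => Equiv.ext fun j => ?_⟩
  · have := perm_addStrand_castSucc β j
    rw [h, Equiv.Perm.one_apply] at this
    exact (Fin.castSucc_injective n this).symm
  · induction j using Fin.lastCases with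
    | last => rw [perm_addStrand_last, Equiv.Perm.one_apply]
    | cast j => rw [perm_addStrand_castSucc, h, Equiv.Perm.one_apply, Equiv.Perm.one_apply]

theorem commute_gen_addStrand [Fact T.IsRegular] {x : T.Tag} (hx : T.Dominates x) (a : T.Tag)
    (β : T.Braid n) :
    Commute (gen T (n + 2) n a) (addStrand T (n + 1) (addStrand T n β)) := by
  induction β using braid_induction with
  | one => simp
  | mul_gen β i b hi ih =>
    rw [map_mul, map_mul, addStrand_gen hi, addStrand_gen (by omega)]
    exact ih.mul_right ((dominantSystem_gen hx).comm (by omega) (by omega) _ _).symm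

theorem addStrand_mem_blockProducts [Fact T.IsRegular] {x : T.Tag} (hx : T.Dominates x)
    (ih : PureBraidsQuasitoric T n) {β : T.Braid (n + 1)} (hβ : β ∈ T.pureBraids (n + 1)) :
    addStrand T (n + 1) β ∈ blockProducts (gen T (n + 2)) (n + 1) := by
  obtain ⟨l, rfl⟩ := exists_list_of_mem_blockProducts (ih β hβ)
  rw [map_list_prod, List.map_map]
  have h : addStrand T (n + 1) ∘ blk (gen T (n + 1)) n = blk (gen T (n + 2)) n :=
    funext addStrand_blk
  rw [h]
  exact (dominantSystem_gen (n := n + 2) hx).prod_blk_mem_of_dvd l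
    ((prod_blk_mem_pureBraids_iff l).1 hβ)

theorem inv_mem_pureBraids [Fact T.IsRegular] {β : T.Braid n} (hβ : β ∈ T.pureBraids n) :
    β⁻¹ ∈ T.pureBraids n := by
  rw [pureBraids, MonoidHom.mem_mker] at hβ ⊢
  rw [map_inv, hβ, inv_one]

/-- A braid commuting with all braids on the first strands but two lies with all its conjugates
under braids on the first strands but one in the block products if it does so for conjugators that
bring each of the strands to the last position. -/
theorem conj_mem_blockProducts [Fact T.IsRegular] {x : T.Tag} (hx : T.Dominates x)
    (ih : PureBraidsQuasitoric T n) {c : T.Braid (n + 2)}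
    (hc : ∀ σ : T.Braid n, Commute c (addStrand T (n + 1) (addStrand T n σ)))
    (hr : ∀ j : Fin (n + 1), ∃ ρ : T.Braid (n + 1), T.perm (n + 1) ρ (Fin.last n) = j ∧
      addStrand T (n + 1) ρ * c * (addStrand T (n + 1) ρ)⁻¹ ∈
        blockProducts (gen T (n + 2)) (n + 1)) (γ : T.Braid (n + 1)) :
    addStrand T (n + 1) γ * c * (addStrand T (n + 1) γ)⁻¹ ∈
      blockProducts (gen T (n + 2)) (n + 1) := by
  obtain ⟨ρ, hρ, hmem⟩ := hr (T.perm (n + 1) γ (Fin.last n))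
  obtain ⟨σ, hσ⟩ := exists_perm_addStrand_eq (T := T) x
    ((T.perm (n + 1) ρ)⁻¹ * T.perm (n + 1) γ) (by simp [← hρ])
  -- With `p` this pure braid, `γ = p ρ σ`; as `σ` commutes with `c`, conjugation by `γ` is that by
  -- `ρ` followed by that by `p`.
  have hp : γ * (addStrand T n σ)⁻¹ * ρ⁻¹ ∈ T.pureBraids (n + 1) := by
    rw [pureBraids, MonoidHom.mem_mker, map_mul, map_mul, map_inv, map_inv, hσ]
    group
  convert mul_mem (mul_mem (addStrand_mem_blockProducts hx ih hp) hmem)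
    (addStrand_mem_blockProducts hx ih (inv_mem_pureBraids hp)) using 1
  simp only [map_mul, map_inv, mul_inv_rev, inv_inv, mul_assoc, inv_mul_cancel_left]
  rw [← mul_assoc c (addStrand T (n + 1) (addStrand T n σ)), (hc σ).eq]
  simp only [mul_assoc, inv_mul_cancel_left]

theorem perm_seg_pow_modEq (x : T.Tag) (k : ℕ) (j : Fin (n + 1)) :
    (T.perm (n + 1) (seg (gen T (n + 1) · x) 0 n ^ k) j : ℕ) + k ≡ j [MOD n + 1] := by
  simpa [blk] using perm_prod_blk_modEq (List.replicate k fun _ => x) j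

theorem seg_pow_mem_pureBraids (x : T.Tag) :
    seg (gen T (n + 1) · x) 0 n ^ (n + 1) ∈ T.pureBraids (n + 1) := by
  simpa [blk] using (prod_blk_mem_pureBraids_iff (n := n) (List.replicate (n + 1) fun _ => x)).2 (by simp)

theorem perm_seg_inv_last [Fact T.IsRegular] (x : T.Tag) {k r : ℕ} (h : k + r = n) :
    (T.perm (n + 1) (seg (gen T (n + 1) · x) k r)⁻¹ (Fin.last n) : ℕ) = k := by
  rw [map_inv]
  induction r generalizing k with
  | zero => simpa using h.symm
  | succ r ih =>
    rw [seg_succ', map_mul, mul_inv_rev, Equiv.Perm.mul_apply]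
    have h₁ := ih (k := k + 1) (by omega)
    rw [show (T.perm (n + 1) (seg (gen T (n + 1) · x) (k + 1) r))⁻¹ (Fin.last n) =
      (⟨k + 1, by omega⟩ : Fin (n + 1)) from Fin.ext h₁]
    have h₂ : T.perm (n + 1) (gen T (n + 1) k x) ⟨k, by omega⟩ = ⟨k + 1, by omega⟩ := by
      ext
      simp [perm_gen_apply_val (n := n + 1) (show k < n + 1 - 1 by omega)]
    rw [← h₂]
    simp

theorem conj_mul_mem [Fact T.IsRegular] {x : T.Tag} (hx : T.Dominates x)
    (ih : PureBraidsQuasitoric T n) (a : T.Tag) (γ : T.Braid (n + 1)) :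
    addStrand T (n + 1) γ * (gen T (n + 2) n x * gen T (n + 2) n a) *
      (addStrand T (n + 1) γ)⁻¹ ∈ blockProducts (gen T (n + 2)) (n + 1) := by
  refine conj_mem_blockProducts hx ih (fun σ => (commute_gen_addStrand hx x σ).mul_left
    (commute_gen_addStrand hx a σ)) (fun j => ?_) γ
  have hδ : addStrand T (n + 1) (seg (gen T (n + 1) · x) 0 n) = seg (gen T (n + 2) · x) 0 n :=
    addStrand_seg (by omega) fun _ => x
  -- Each factor `δ` lowers the position by one, so `n - j` factors lead from `n` to `j`.
  refine ⟨seg (gen T (n + 1) · x) 0 n ^ (n - j : ℕ), Fin.ext ?_, ?_⟩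
  · have h := perm_seg_pow_modEq (T := T) x (n - j : ℕ) (Fin.last n)
    rw [show (Fin.last n : ℕ) = j + (n - j) by rw [Fin.val_last]; omega] at h
    exact (Nat.ModEq.add_right_cancel' _ h).eq_of_lt_of_lt (Fin.is_lt _) (Fin.is_lt _)
  · convert mul_mem ((dominantSystem_gen (n := n + 2) hx).pow_mul_mul_pow_mem (k := n - j)
      (Nat.sub_le _ _) a) (addStrand_mem_blockProducts hx ih
        (inv_mem_pureBraids (seg_pow_mem_pureBraids (T := T) x))) using 1
    rw [map_inv, map_pow, map_pow, hδ, mul_assoc _ _ (_ ^ (n + 1))⁻¹]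
    congr 1
    rw [inv_eq_iff_eq_inv, mul_inv_rev, inv_inv, eq_mul_inv_iff_mul_eq, ← pow_add]
    congr 1
    omega

theorem conj_div_mem [Fact T.IsRegular] {x : T.Tag} (hx : T.Dominates x)
    (ih : PureBraidsQuasitoric T n) (a : T.Tag) (γ : T.Braid (n + 1)) :
    addStrand T (n + 1) γ * (gen T (n + 2) n a * (gen T (n + 2) n x)⁻¹) *
      (addStrand T (n + 1) γ)⁻¹ ∈ blockProducts (gen T (n + 2)) (n + 1) := by
  refine conj_mem_blockProducts hx ih (fun σ => (commute_gen_addStrand hx a σ).mul_left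
    (commute_gen_addStrand hx x σ).inv_left) (fun j => ?_) γ
  refine ⟨(seg (gen T (n + 1) · x) j (n - j))⁻¹, Fin.ext (perm_seg_inv_last x (by omega)), ?_⟩
  convert mul_mem ((dominantSystem_gen (n := n + 2) hx).conj_mul_pow_mem (k := j)
    (by omega) a) (addStrand_mem_blockProducts hx ih
      (inv_mem_pureBraids (seg_pow_mem_pureBraids (T := T) x))) using 1
  rw [map_inv, map_inv, map_pow, inv_inv, addStrand_seg (by omega) fun _ => x,
    addStrand_seg (by omega) fun _ => x, mul_inv_cancel_right]

theorem conj_mul_mem_pureBraids [Fact T.IsRegular] {x : T.Tag} (a : T.Tag) (γ : T.Braid (n + 2)) :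
    γ * (gen T (n + 2) n x * gen T (n + 2) n a) * γ⁻¹ ∈ T.pureBraids (n + 2) := by
  rw [pureBraids, MonoidHom.mem_mker, map_mul, map_mul, map_mul, map_inv,
    gen_of_lt (show n < n + 2 - 1 by omega), gen_of_lt (show n < n + 2 - 1 by omega), perm_elem,
    perm_elem]
  simp [adjSwap]

theorem conj_div_mem_pureBraids [Fact T.IsRegular] {x : T.Tag} (a : T.Tag) (γ : T.Braid (n + 2)) :
    γ * (gen T (n + 2) n a * (gen T (n + 2) n x)⁻¹) * γ⁻¹ ∈ T.pureBraids (n + 2) := by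
  rw [pureBraids, MonoidHom.mem_mker, map_mul, map_mul, map_mul, map_inv, map_inv,
    gen_of_lt (show n < n + 2 - 1 by omega), gen_of_lt (show n < n + 2 - 1 by omega), perm_elem,
    perm_elem]
  simp

/-- Every braid is a pure product of blocks, followed by a braid on all strands but the last and by
a move of the last strand to another position. -/
theorem exists_eq_mul_addStrand_mul_seg [Fact T.IsRegular] {x : T.Tag} (hx : T.Dominates x)
    (ih : PureBraidsQuasitoric T n) (β : T.Braid (n + 2)) :
    ∃ q ∈ blockProducts (gen T (n + 2)) (n + 1) ⊓ T.pureBraids (n + 2), ∃ γ : T.Braid (n + 1),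
      ∃ k r, k + r = n + 1 ∧ β = q * addStrand T (n + 1) γ * seg (gen T (n + 2) · x) k r := by
  have S := dominantSystem_gen (n := n + 2) hx
  induction β using braid_induction with
  | one => exact ⟨1, one_mem _, 1, n + 1, 0, rfl, by simp⟩
  | mul_gen β i a hi h =>
    obtain ⟨q, hq, γ, k, r, hkr, rfl⟩ := h
    -- Away from the ends of the run the crossing passes through it into `γ`; at `i = k` the run
    -- shrinks, at `i + 1 = k` it grows, and a conjugate goes into `q`.
    rcases lt_or_ge (i + 1) k with h₁ | h₁
    · refine ⟨q, hq, γ * gen T (n + 1) i a, k, r, hkr, ?_⟩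
      have := (S.commute_seg_above h₁ (by omega) a fun _ => x : Commute _ (seg _ k r)).eq
      rw [map_mul, addStrand_gen (by omega), mul_assoc, ← this]
      simp only [mul_assoc]
    rcases lt_or_ge k i with h₂ | h₂
    · obtain ⟨i, rfl⟩ := Nat.exists_eq_add_of_le' (show 1 ≤ i by omega)
      refine ⟨q, hq, γ * gen T (n + 1) i a, k, r, hkr, ?_⟩
      rw [map_mul, addStrand_gen (by omega), mul_assoc,
        ← S.slide_seg (by omega) (by omega) (by omega)]
      simp only [mul_assoc]
    have hseg : ∀ j s, j + s = n → addStrand T (n + 1) (seg (gen T (n + 1) · x) j s) =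
        seg (gen T (n + 2) · x) j s := fun j s _ => addStrand_seg (by omega) fun _ => x
    rcases h₂.eq_or_lt with rfl | h₃
    · obtain ⟨r, rfl⟩ := Nat.exists_eq_add_of_le' (show 1 ≤ r by omega)
      obtain rfl : i + r = n := by omega
      refine ⟨_, mul_mem hq ⟨conj_mul_mem hx ih a (γ * (seg (gen T (i + r + 1) · x) i r)⁻¹),
        conj_mul_mem_pureBraids a _⟩, γ, i + 1, r, by omega, ?_⟩
      rw [mul_assoc, S.seg_mul_elem_mul (by omega), map_mul, map_inv, hseg _ _ rfl]
      group
    · obtain rfl : k = i + 1 := by omega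
      obtain rfl : i + r = n := by omega
      refine ⟨_, mul_mem hq ⟨conj_div_mem hx ih a (γ * (seg (gen T (i + r + 1) · x) i r)⁻¹),
        conj_div_mem_pureBraids a _⟩, γ, i, r + 1, by omega, ?_⟩
      rw [mul_assoc, S.seg_mul_elem_div (by omega), map_mul, map_inv, hseg _ _ rfl]
      group

theorem PureBraidsQuasitoric.succ [Fact T.IsRegular] {x : T.Tag} (hx : T.Dominates x)
    (ih : PureBraidsQuasitoric T n) : PureBraidsQuasitoric T (n + 1) := by
  intro β hβ
  obtain ⟨q, ⟨hq, hq'⟩, γ, k, r, hkr, rfl⟩ := exists_eq_mul_addStrand_mul_seg hx ih β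
  have hq'' : T.perm (n + 2) q = 1 := hq'
  have hβ' : T.perm (n + 2) _ = 1 := hβ
  rw [map_mul, map_mul, hq'', one_mul] at hβ'
  cases r with
  | zero =>
    rw [seg_zero, map_one, mul_one] at hβ'
    rw [seg_zero, mul_one]
    exact mul_mem hq (addStrand_mem_blockProducts hx ih (addStrand_mem_pureBraids.1 hβ'))
  | succ r =>
    -- A nonempty run would move the last strand, while `γ` and `q` do not.
    exfalso
    obtain rfl : k + r = n := by omega
    have h := Equiv.ext_iff.1 hβ' (Fin.last _)
    have h₁ : T.perm (k + r + 2) (gen T (k + r + 2) (k + r) x) (Fin.last _) =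
        (Fin.last (k + r)).castSucc := by
      ext
      simp [perm_gen_apply_val (n := k + r + 2) (show k + r < k + r + 2 - 1 by omega)]
    have h₂ : addStrand T (k + r + 1) (seg (gen T (k + r + 1) · x) k r) =
        seg (gen T (k + r + 2) · x) k r := addStrand_seg (by omega) fun _ => x
    rw [seg_succ, map_mul, ← h₂, Equiv.Perm.mul_apply, Equiv.Perm.mul_apply, perm_addStrand_last,
      h₁, perm_addStrand_castSucc, Equiv.Perm.one_apply] at h
    exact (Fin.castSucc_lt_last _).ne h

theorem pureBraidsQuasitoric [Fact T.IsRegular] {x : T.Tag} (hx : T.Dominates x) :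
    ∀ n, PureBraidsQuasitoric T n
  | 0 => fun β _ => by
    induction β using braid_induction with
    | one => exact one_mem _
    | mul_gen β i a hi => omega
  | n + 1 => (pureBraidsQuasitoric hx n).succ hx

theorem block_eq_blk (y : ℕ → T.Tag) :
    block (fun i : Fin n => y i) = blk (gen T (n + 1)) n y := by
  have h : ∀ m (hm : m ≤ n), (((List.finRange m).map (Fin.castLE hm)).reverse.map
      fun i => (elem (n := n + 1) i (y i) : T.Braid (n + 1))).prod =
        seg (fun i => gen T (n + 1) i (y i)) 0 m := by
    intro m hm
    induction m with
    | zero => simp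
    | succ m ih =>
      rw [seg_succ, ← ih (by omega), List.finRange_succ_last, gen_of_lt (by omega)]
      simp [Function.comp_def]
      rfl
  simpa [block, blk] using h n le_rfl

end PureBraids

end BraidTheory

theorem mainTheorem3 (T : BraidTheory.{u}) (hT : T.IsNormal) (n : ℕ) (hn : 1 ≤ n)
    (β : T.Braid n) (hβ : β ∈ T.pureBraids n) : BraidTheory.IsQuasitoric β := by
  obtain ⟨hreg, x, hx⟩ := hT
  have := Fact.mk hreg
  obtain ⟨n, rfl⟩ := Nat.exists_eq_add_of_le' hn
  have hpow := BraidTheory.seg_pow_mem_pureBraids (T := T) (n := n) x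
  -- The list `l` may be empty. Writing `β` as `(β δ⁻⁽ⁿ⁺¹⁾) δⁿ⁺¹` makes the number of blocks
  -- positive.
  obtain ⟨l, hl⟩ := BraidTheory.exists_list_of_mem_blockProducts
    (BraidTheory.pureBraidsQuasitoric hx n _ (mul_mem hβ (BraidTheory.inv_mem_pureBraids hpow)))
  have h : β = ((l ++ List.replicate (n + 1) fun _ => x).map
      (BraidTheory.blk (BraidTheory.gen T (n + 1)) n)).prod := by
    rw [List.map_append, List.prod_append, hl]
    simp [BraidTheory.blk]
  refine ⟨_, ?_, fun j i => (l ++ List.replicate (n + 1) fun _ => x).get j i, ?_⟩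
  · simp
  · rw [h]
    congr 1
    conv_lhs => rw [← List.ofFn_get (l ++ List.replicate (n + 1) fun _ => x)]
    rw [List.map_ofFn]
    congr 1
    funext j
    exact (BraidTheory.block_eq_blk _).symm
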